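/- Let $p$ be a prime and let $R$ be a regular (Noetherian, not necessarily local) commutative ring of characteristic $p$ that is $F$-finite, i.e. the Frobenius morphism $x\mapsto x^p$ of $R$ is finite. For an ideal $J$ of $R$ and $e\ge 0$ let $J^{[p^e]}$ be the ideal generated by all $u^{p^e}$ with $u\in J$, and for an ideal $\mathfrak b$ let $\mathfrak b^{[1/p^e]}$ be the smallest ideal $J$ with $\mathfrak b\subseteq J^{[p^e]}$. For an ideal $\mathfrak a$ of $R$ and a real number $c>0$ let $$\tau(\mathfrak a^c)=\bigcup_{e>0}\bigl(\mathfrak a^{\lceil cp^e\rceil}\bigr)^{[1/p^e]}$$ be the generalized test ideal, and let $\tau(\mathfrak a^0)$ be the smallest ideal that contains $\mathfrak a$ and is generated by an idempotent (so if $R$ is a domain, $\tau(\mathfrak a^0)=R$ for $\mathfrak a\ne(0)$ and $\tau(\mathfrak a^0)=(0)$ for $\mathfrak a=(0)$). A real number $c>0$ is an $F$-jumping exponent of $\mathfrak a$ if $\tau(\mathfrak a^c)\neq\tau(\mathfrak a^{c-\varepsilon})$ for every $0<\varepsilon\le c$; by convention $0$ is also an $F$-jumping exponent of $\mathfrak a$.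 For an ideal $J$ of $R$ with $\mathfrak a\subseteq\operatorname{rad}(J)$ let $\nu^J_{\mathfrak a}(p^e)$ be the largest integer $r\ge 0$ with $\mathfrak a^r\not\subseteq J^{[p^e]}$ (and $0$ if there is no such $r$), and let $$c^J(\mathfrak a)=\sup_{e\ge1}\frac{\nu^J_{\mathfrak a}(p^e)}{p^e}$$ be the $F$-threshold of $\mathfrak a$ with respect to $J$. Then for every ideal $\mathfrak a$ of $R$, the set of $F$-jumping exponents of $\mathfrak a$ is equal to the set $$\{\,c^J(\mathfrak a) : J\subseteq R \text{ an ideal with } \mathfrak a\subseteq\operatorname{rad}(J)\,\}.$$ -/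

import Mathlib

noncomputable section

namespace FTest

variable {R : Type*} [CommRing R]

/-- The Frobenius power `J^[p^e]`: the ideal generated by the elements `u^(p^e)` with `u ∈ J`. -/
def frobPower (p e : ℕ) (J : Ideal R) : Ideal R :=
  Ideal.span ((fun u : R => u ^ p ^ e) '' (J : Set R))

/-- The ideal `b^[1/p^e]`: the smallest ideal `J` with `b ⊆ J^[p^e]`. In a regular F-finite ring
the intersection of all such `J` is again such an ideal, so it is the smallest one. -/
def frobRoot (p e : ℕ) (b : Ideal R) : Ideal R :=
  sInf {J : Ideal R | b ≤ frobPower p e J}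

/-- The convention for the test ideal with exponent `0`: the smallest ideal containing `a` that is
generated by an idempotent. For a domain this is `0` if `a = 0` and `R` otherwise; for a product
of domains `R₁ × ⋯ × Rₘ` (such as a regular ring) and `a = a₁ × ⋯ × aₘ`, it is the product of the
corresponding ideals of the factors. -/
def testIdealZero (a : Ideal R) : Ideal R :=
  sInf {K : Ideal R | a ≤ K ∧ ∃ u : R, IsIdempotentElem u ∧ K = Ideal.span {u}}

/-- The generalized test ideal `τ(a^c)`, for real `c ≥ 0`. For `c > 0` it is the union over
`e > 0` of the ideals `(a^⌈c p^e⌉)^[1/p^e]`; these form an increasing chain in a regular F-finite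
ring, so their union is their supremum in the lattice of ideals. (Negative `c` is never used.) -/
def testIdeal (p : ℕ) (a : Ideal R) (c : ℝ) : Ideal R :=
  open Classical in
  if c = 0 then testIdealZero a
  else ⨆ e : ℕ, ⨆ _ : 0 < e, frobRoot p e (a ^ ⌈c * (p : ℝ) ^ e⌉₊)

/-- `c` is an F-jumping exponent of `a`: either `c = 0` (by convention), or `c > 0` and
`τ(a^c) ≠ τ(a^(c - ε))` for every positive `ε` for which the exponent `c - ε` makes sense. -/
def IsFJumpingExponent (p : ℕ) (a : Ideal R) (c : ℝ) : Prop :=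
  c = 0 ∨ (0 < c ∧ ∀ ε : ℝ, 0 < ε → ε ≤ c → testIdeal p a c ≠ testIdeal p a (c - ε))

/-- `ν_a^J(p^e)`: the largest `r` with `a^r ⊄ J^[p^e]`, and `0` if there is no such `r`
(the supremum of the empty set of natural numbers is `0`). -/
def nu (p : ℕ) (a J : Ideal R) (e : ℕ) : ℕ :=
  sSup {r : ℕ | ¬ a ^ r ≤ frobPower p e J}

/-- The F-threshold `c^J(a) = sup_{e ≥ 1} ν_a^J(p^e) / p^e`. -/
def fThreshold (p : ℕ) (a J : Ideal R) : ℝ :=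
  ⨆ e : ℕ+, (nu p a J e : ℝ) / (p : ℝ) ^ (e : ℕ)

/-! The suprema in `nu` and `fThreshold` are suprema of bounded sets when `a ⊆ rad J` in a
Noetherian ring. -/

theorem span_pow_card_mul_le (p e : ℕ) (s : Finset R) (J : Ideal R) (hs : ∀ x ∈ s, x ∈ J) :
    Ideal.span (s : Set R) ^ (s.card * p ^ e + 1) ≤ frobPower p e J := by
  classical
  suffices h : ∀ t : Finset R, t ⊆ s → t.Nonempty →
      Ideal.span (t : Set R) ^ (t.card * p ^ e) ≤ frobPower p e J by
    rcases s.eq_empty_or_nonempty with rfl | hne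
    · simp
    · exact (Ideal.pow_le_pow_right (Nat.le_succ _)).trans (h s subset_rfl hne)
  intro t hts ht
  induction ht using Finset.Nonempty.cons_induction with
  | singleton x =>
    simp only [Finset.coe_singleton, Finset.card_singleton, one_mul, Ideal.span_singleton_pow,
      Ideal.span_singleton_le_iff_mem]
    exact Ideal.subset_span ⟨x, hs x (hts (by simp)), rfl⟩
  | cons x t hx ht ih =>
    rw [Finset.card_cons, Finset.coe_cons, Set.insert_eq, Ideal.span_union, add_mul, one_mul,
      add_comm]
    refine Ideal.sup_pow_add_le_pow_sup_pow.trans (sup_le ?_ (ih fun y hy => hts (by simp [hy])))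
    rw [Ideal.span_singleton_pow, Ideal.span_singleton_le_iff_mem]
    exact Ideal.subset_span ⟨x, hs x (hts (by simp)), rfl⟩

theorem exists_pow_le_frobPower [IsNoetherianRing R] {p : ℕ} (hp : 0 < p) {a J : Ideal R}
    (h : a ≤ J.radical) : ∃ M : ℕ, ∀ e : ℕ, a ^ (M * p ^ e) ≤ frobPower p e J := by
  obtain ⟨l, hl⟩ := Ideal.exists_pow_le_of_le_radical_of_fg h (IsNoetherian.noetherian a)
  obtain ⟨s, hs⟩ := IsNoetherian.noetherian (a ^ l)
  refine ⟨l * (s.card + 1), fun e => ?_⟩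
  rw [mul_assoc, pow_mul]
  have h1 := span_pow_card_mul_le p e s J fun x hx =>
    hl (hs ▸ Submodule.subset_span hx)
  rw [show Ideal.span (s : Set R) = a ^ l from hs] at h1
  refine (Ideal.pow_le_pow_right ?_).trans h1
  have : 0 < p ^ e := pow_pos hp e
  nlinarith

theorem nu_bddAbove [IsNoetherianRing R] {p : ℕ} (hp : 0 < p) {a J : Ideal R}
    (h : a ≤ J.radical) (e : ℕ) : BddAbove {r : ℕ | ¬ a ^ r ≤ frobPower p e J} := by
  obtain ⟨M, hM⟩ := exists_pow_le_frobPower hp h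
  refine ⟨M * p ^ e, fun r hr => ?_⟩
  by_contra! hlt
  exact hr ((Ideal.pow_le_pow_right hlt.le).trans (hM e))

theorem fThreshold_bddAbove [IsNoetherianRing R] {p : ℕ} (hp : 0 < p) {a J : Ideal R}
    (h : a ≤ J.radical) :
    BddAbove (Set.range fun e : ℕ+ => (nu p a J e : ℝ) / (p : ℝ) ^ (e : ℕ)) := by
  obtain ⟨M, hM⟩ := exists_pow_le_frobPower hp h
  refine ⟨M, ?_⟩
  rintro _ ⟨e, rfl⟩
  have hp' : (0 : ℝ) < (p : ℝ) ^ (e : ℕ) := pow_pos (by exact_mod_cast hp) _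
  have : nu p a J e ≤ M * p ^ (e : ℕ) := by
    refine csSup_le' fun r hr => ?_
    by_contra! hlt
    exact hr ((Ideal.pow_le_pow_right hlt.le).trans (hM e))
  simp only
  rw [div_le_iff₀ hp']
  exact_mod_cast this

end FTest

end

/-!
The engine is that the Frobenius of an F-finite regular ring `R` is flat (the easy half of Kunz's
theorem), so each iterate `F^e : R → R` is finite and flat, hence projective. Projectivity gives
`R`-linear coordinates on the target of `F^e` that detect membership in every extended ideal
`J^[p^e]` (`RingHom.Flat.exists_coordinates`). Consequently Frobenius powers commute with arbitrary
intersections and with colons by an element; in particular `b^[1/p^e] ≤ J` if and only if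
`b ≤ J^[p^e]` (`FTest.frobRoot_le_iff`).

Flatness is checked at the localizations. In a regular local ring the maximal ideal is generated by
a regular sequence `x₁, …, x_d`. Then `x₁^p, …, x_d^p` is regular as well, which says that
`x₁, …, x_d` is regular on the target of Frobenius; a finite module on which a sequence generating
the maximal ideal is regular is free.

By the adjunction, for `c > 0` we have `τ(a^c) ≤ J` iff `a^⌈c p^e⌉ ≤ J^[p^e]` for all `e > 0`,
that is, iff `ν(p^e) / p^e < c` for all `e > 0` (`FTest.testIdeal_le_iff_nu_lt`). So `τ(a^c) ≤ J`
for `c > c^J(a)` and `τ(a^c) ≰ J` for `0 < c < c^J(a)`. The remaining ingredient is right-continuity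
of `c ↦ τ(a^c)` (`FTest.exists_lt_testIdeal_le`), which gives `τ(a^c) ≤ J` for `c = c^J(a)` too, if
this is positive: the threshold is a jumping exponent. Conversely, a jumping exponent `c > 0` is the
threshold of `J = τ(a^c)`, and `0` is the threshold of `J = R`.

The exponent `0` is handled through the increasing chain `a^[1/p^e]`: its stable value `K` satisfies
`K ≤ K^[p] ≤ K²`, so it is generated by an idempotent, and it equals `τ(a^0)`
(`FTest.exists_testIdealZero`). The same ideal settles right-continuity at those `c` for which
`c p^e` is an integer.
-/

/-! ### Regular sequences and free modules over local rings -/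

section Kunz

open IsLocalRing RingTheory.Sequence

lemma QuotSMulTop.finite {A M : Type*} [CommRing A] [AddCommGroup M] [Module A M]
    [Module.Finite A M] (x : A) : Module.Finite (A ⧸ Ideal.span {x}) (QuotSMulTop x M) :=
  Module.Finite.of_restrictScalars_finite A _ _

/-- A special case of the Auslander–Buchsbaum formula: induction on the length of the sequence,
freeness being detected modulo a regular element of the maximal ideal. -/
theorem Module.free_of_isWeaklyRegular_of_ofList_eq_maximalIdeal {A M : Type*} [CommRing A]
    [IsLocalRing A] [IsNoetherianRing A] [AddCommGroup M] [Module A M] [Module.Finite A M]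
    (rs : List A) (hrs : Ideal.ofList rs = maximalIdeal A) (hreg : IsWeaklyRegular M rs) :
    Module.Free A M := by
  obtain ⟨n, hn⟩ : ∃ n, rs.length = n := ⟨_, rfl⟩
  induction n generalizing A M with
  | zero =>
    obtain rfl := List.length_eq_zero_iff.mp hn
    rw [Ideal.ofList_nil] at hrs
    let := (IsLocalRing.isField_iff_maximalIdeal_eq.mpr hrs.symm).toField
    infer_instance
  | succ n ih =>
    obtain ⟨x, rs, rfl⟩ := List.exists_cons_of_length_eq_add_one hn
    have hx : x ∈ maximalIdeal A := hrs ▸ Ideal.subset_span (by simp)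
    rw [isWeaklyRegular_cons_iff'] at hreg
    have : Module.FinitePresentation A M := Module.finitePresentation_of_finite A M
    have hle : Ideal.span {x} ≤ maximalIdeal A := by simpa [Ideal.span_le] using hx
    have : Nontrivial (A ⧸ Ideal.span {x}) :=
      Ideal.Quotient.nontrivial_iff.mpr (hle.trans_lt (maximalIdeal.isMaximal A).ne_top.lt_top).ne
    have : IsLocalRing (A ⧸ Ideal.span {x}) :=
      IsLocalRing.of_surjective' (Ideal.Quotient.mk _) Ideal.Quotient.mk_surjective
    have := QuotSMulTop.finite (M := M) x
    refine (Module.free_quotSMulTop_iff_free A M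
      (maximalIdeal_le_jacobson ⊥ hx) hreg.1).mp (ih _ ?_ hreg.2 (by simpa using hn))
    rw [← Ideal.map_ofList]
    have h2 : (maximalIdeal A).map (Ideal.Quotient.mk (Ideal.span {x})) =
        maximalIdeal (A ⧸ Ideal.span {x}) :=
      IsLocalRing.map_maximalIdeal_of_surjective _ Ideal.Quotient.mk_surjective
    rw [← h2, ← hrs, Ideal.ofList_cons, Ideal.map_sup, eq_comm]
    simp [Ideal.map_span]

theorem RingTheory.Sequence.IsWeaklyRegular.map_pow {A M : Type*} [CommRing A]
    [IsLocalRing A] [AddCommGroup M] [Module A M] [IsNoetherian A M] {rs : List A}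
    (hrs : ∀ r ∈ rs, r ∈ maximalIdeal A) (hreg : IsWeaklyRegular M rs) {n : ℕ} (hn : n ≠ 0) :
    IsWeaklyRegular M (rs.map (· ^ n)) := by
  suffices h : ∀ l₁ l₂ : List A, (∀ r ∈ l₁, r ∈ maximalIdeal A) → (∀ r ∈ l₂, r ∈ maximalIdeal A) →
      IsWeaklyRegular M (l₁ ++ l₂) → IsWeaklyRegular M (l₁.map (· ^ n) ++ l₂) by
    simpa using h rs [] hrs (by simp) (by simpa using hreg)
  intro l₁
  induction l₁ with
  | nil => simp
  | cons x l ih =>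
    intro l₂ h1 h2 h
    have hx : x ∈ maximalIdeal A := h1 x (by simp)
    have hl : ∀ r ∈ l, r ∈ maximalIdeal A := fun r hr => h1 r (by simp [hr])
    -- a permutation brings `x` to the end, where it may be replaced by a power
    have h3 : IsWeaklyRegular M (l ++ (l₂ ++ [x])) :=
      IsLocalRing.isWeaklyRegular_of_perm_of_subset_maximalIdeal h
        (by rw [← List.append_assoc]; exact (List.perm_append_singleton x (l ++ l₂)).symm)
        (by simpa [or_imp, forall_and] using ⟨hx, hl, h2⟩)
    have h4 := ih (l₂ ++ [x]) hl (by simpa [or_imp, forall_and] using ⟨h2, hx⟩) h3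
    rw [← List.append_assoc, isWeaklyRegular_append_iff, isWeaklyRegular_singleton_iff] at h4
    have h5 : IsWeaklyRegular M (l.map (· ^ n) ++ l₂ ++ [x ^ n]) := by
      rw [isWeaklyRegular_append_iff, isWeaklyRegular_singleton_iff]
      exact ⟨h4.1, h4.2.pow n⟩
    refine IsLocalRing.isWeaklyRegular_of_perm_of_subset_maximalIdeal h5
      (List.perm_append_singleton _ _) ?_
    have hp : x ^ n ∈ maximalIdeal A := Ideal.pow_mem_of_mem _ hx n (Nat.pos_of_ne_zero hn)
    have hl' : ∀ r ∈ l, r ^ n ∈ maximalIdeal A :=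
      fun r hr => Ideal.pow_mem_of_mem _ (hl r hr) n (Nat.pos_of_ne_zero hn)
    intro r hr
    simp only [List.mem_append, List.mem_map, List.mem_singleton] at hr
    rcases hr with (⟨y, hy, rfl⟩ | hr) | rfl
    exacts [hl' y hy, h2 r hr, hp]

/-! ### Regular local rings -/

/-- Steinitz exchange: an element of `𝔪 \ 𝔪²` belongs to a generating set of `𝔪` with at most as
many elements as a minimal one. -/
theorem IsLocalRing.exists_card_lt_span_insert_eq_maximalIdeal {A : Type*} [CommRing A]
    [IsLocalRing A] [IsNoetherianRing A] {x : A} (hx : x ∈ maximalIdeal A)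
    (hx2 : x ∉ maximalIdeal A ^ 2) :
    ∃ t : Finset A, t.card + 1 ≤ (maximalIdeal A).spanFinrank ∧
      Ideal.span (insert x (t : Set A)) = maximalIdeal A := by
  classical
  obtain ⟨s, hs, hspan⟩ := Submodule.FG.exists_span_finset_card_eq_spanFinrank
    (maximalIdeal A).fg_of_isNoetherianRing
  have hxs := hx
  rw [← hspan] at hxs
  obtain ⟨f, -, hf⟩ := Submodule.mem_span_finset.mp hxs
  have hsm : ∀ y ∈ s, y ∈ maximalIdeal A := fun y hy => hspan ▸ Submodule.subset_span hy
  obtain ⟨y, hy, hfy⟩ : ∃ y ∈ s, f y ∉ maximalIdeal A := by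
    by_contra! hcon
    refine hx2 (hf ▸ Ideal.sum_mem _ fun y hy => ?_)
    rw [pow_two]
    exact Ideal.mul_mem_mul (hcon y hy) (hsm y hy)
  refine ⟨s.erase y, by rw [Finset.card_erase_add_one hy, hs], le_antisymm ?_ ?_⟩
  · rw [Ideal.span_le]
    intro z hz
    rcases hz with rfl | hz
    exacts [hx, hsm z (Finset.mem_of_mem_erase hz)]
  · refine hspan.symm.trans_le (Submodule.span_le.mpr fun z hz => ?_)
    by_cases hzy : z = y
    · subst hzy
      rw [← Finset.add_sum_erase _ _ hy] at hf
      have hu : IsUnit (f z) := by simpa using hfy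
      rw [SetLike.mem_coe, ← Ideal.unit_mul_mem_iff_mem _ hu]
      rw [smul_eq_mul, ← eq_sub_iff_add_eq] at hf
      rw [hf]
      refine Ideal.sub_mem _ (Ideal.subset_span (by simp)) (Ideal.sum_mem _ fun w hw => ?_)
      exact Ideal.mul_mem_left _ _ (Ideal.subset_span (Or.inr hw))
    · exact Ideal.subset_span (Or.inr (by simpa [hzy] using hz))

/-- Prime avoidance for `𝔪²` and the minimal primes; `𝔪` is contained in none of them
when `dim A > 0`. -/
theorem IsRegularLocalRing.exists_mem_maximalIdeal_notMem {A : Type*} [CommRing A]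
    [IsRegularLocalRing A] (h0 : (maximalIdeal A).spanFinrank ≠ 0) :
    ∃ x ∈ maximalIdeal A, x ∉ maximalIdeal A ^ 2 ∧ ∀ Q ∈ minimalPrimes A, x ∉ Q := by
  classical
  by_contra! hcon
  have hfin : (minimalPrimes A).Finite := minimalPrimes.finite_of_isNoetherianRing A
  let S : Finset (Ideal A) := insert (maximalIdeal A ^ 2) hfin.toFinset
  have hsub : (maximalIdeal A : Set A) ⊆ ⋃ Q ∈ (S : Set (Ideal A)), (id Q : Ideal A) := by
    intro x hx
    by_cases hx2 : x ∈ maximalIdeal A ^ 2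
    · exact Set.mem_biUnion (by simp [S]) hx2
    · obtain ⟨Q, hQ, hxQ⟩ := hcon x hx hx2
      exact Set.mem_biUnion (show Q ∈ (S : Set (Ideal A)) by simp [S, hQ]) hxQ
  obtain ⟨Q, hQS, hQ⟩ := (Ideal.subset_union_prime (maximalIdeal A ^ 2) (maximalIdeal A ^ 2)
    (fun Q hQ h _ => by
      have : Q ∈ minimalPrimes A := by simpa [S, h] using hQ
      exact this.1.1)).mp hsub
  have hfg : (maximalIdeal A).FG := (maximalIdeal A).fg_of_isNoetherianRing
  rw [Finset.mem_insert] at hQS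
  rcases hQS with rfl | hQS
  · apply h0
    rw [Submodule.spanFinrank_eq_zero_iff_eq_bot hfg]
    refine Submodule.eq_bot_of_le_smul_of_le_jacobson_bot (maximalIdeal A) _ hfg ?_
      (maximalIdeal_le_jacobson _)
    simpa [pow_two] using hQ
  · rw [Set.Finite.mem_toFinset] at hQS
    have : Q.IsPrime := hQS.1.1
    have hQm : maximalIdeal A = Q := le_antisymm hQ (IsLocalRing.le_maximalIdeal this.ne_top)
    have h1 : (maximalIdeal A).height = 0 := by
      rw [Ideal.height_eq_zero_iff, hQm]; exact hQS
    have h2 := IsRegularLocalRing.spanFinrank_maximalIdeal (R := A)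
    rw [← maximalIdeal_height_eq_ringKrullDim, h1] at h2
    exact h0 (by exact_mod_cast h2)

/-- A minimal prime `Q` contained in `(x)` satisfies `Q = x Q`, as `x ∉ Q`, so it vanishes by
Nakayama. -/
theorem isDomain_of_isPrime_span_singleton {A : Type*} [CommRing A] [IsLocalRing A]
    [IsNoetherianRing A] {x : A} (hx : x ∈ maximalIdeal A) (hp : (Ideal.span {x}).IsPrime)
    (hmin : ∀ Q ∈ minimalPrimes A, x ∉ Q) : IsDomain A := by
  obtain ⟨Q, hQ, hQx⟩ := Ideal.exists_minimalPrimes_le (I := ⊥) (J := Ideal.span {x}) bot_le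
  have hxQ := hmin Q hQ
  have hQp : Q.IsPrime := hQ.1.1
  have hbot : Q = ⊥ := by
    refine Submodule.eq_bot_of_le_smul_of_le_jacobson_bot (maximalIdeal A) _
      Q.fg_of_isNoetherianRing (fun y hy => ?_) (maximalIdeal_le_jacobson _)
    obtain ⟨z, rfl⟩ := Ideal.mem_span_singleton.mp (hQx hy)
    exact Submodule.smul_mem_smul hx ((hQp.mem_or_mem hy).resolve_left hxQ)
  subst hbot
  exact IsDomain.of_bot_isPrime A

/-- Both facts come out of one induction on the dimension: the quotient by a suitable `x ∈ 𝔪 \ 𝔪²` is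
regular of smaller dimension, hence a domain, which forces `A` to be a domain and `x` to be a
nonzerodivisor. -/
theorem IsRegularLocalRing.isDomain_and_exists_isWeaklyRegular {A : Type*} [CommRing A]
    [IsRegularLocalRing A] :
    IsDomain A ∧ ∃ rs : List A, Ideal.ofList rs = maximalIdeal A ∧ IsWeaklyRegular A rs := by
  classical
  obtain ⟨d, hd⟩ : ∃ d, (maximalIdeal A).spanFinrank = d := ⟨_, rfl⟩
  induction d generalizing A with
  | zero =>
    have hfg : (maximalIdeal A).FG := (maximalIdeal A).fg_of_isNoetherianRing
    rw [Submodule.spanFinrank_eq_zero_iff_eq_bot hfg] at hd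
    refine ⟨(IsLocalRing.isField_iff_maximalIdeal_eq.mpr hd).isDomain, [], ?_, by simp⟩
    rw [Ideal.ofList_nil, hd]
  | succ d ih =>
    obtain ⟨x, hx, hx2, hmin⟩ := IsRegularLocalRing.exists_mem_maximalIdeal_notMem
      (A := A) (by simp [hd])
    obtain ⟨t, ht, hspan⟩ := IsLocalRing.exists_card_lt_span_insert_eq_maximalIdeal hx hx2
    let π := Ideal.Quotient.mk (Ideal.span {x})
    have hle : Ideal.span {x} ≤ maximalIdeal A := by simpa [Ideal.span_le] using hx
    have : Nontrivial (A ⧸ Ideal.span {x}) :=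
      Ideal.Quotient.nontrivial_iff.mpr (hle.trans_lt (maximalIdeal.isMaximal A).ne_top.lt_top).ne
    have : IsLocalRing (A ⧸ Ideal.span {x}) :=
      IsLocalRing.of_surjective' π Ideal.Quotient.mk_surjective
    have hmax : (maximalIdeal A).map π = maximalIdeal (A ⧸ Ideal.span {x}) :=
      IsLocalRing.map_maximalIdeal_of_surjective _ Ideal.Quotient.mk_surjective
    have hgen : maximalIdeal (A ⧸ Ideal.span {x}) = Ideal.span ((t.image π : Finset _) : Set _) := by
      rw [← hmax, ← hspan, Ideal.map_span, Set.image_insert_eq, Ideal.span_insert]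
      simp [π]
    have hrank : (maximalIdeal (A ⧸ Ideal.span {x})).spanFinrank ≤ d := by
      rw [hgen]
      refine (Submodule.spanFinrank_span_le_ncard_of_finite (Finset.finite_toSet _)).trans ?_
      rw [Set.ncard_coe_finset]
      have := Finset.card_image_le (s := t) (f := π)
      omega
    have hdim : ((d + 1 : ℕ) : WithBot ℕ∞) ≤ ringKrullDim (A ⧸ Ideal.span {x}) + 1 := by
      rw [← hd, IsRegularLocalRing.spanFinrank_maximalIdeal]
      rw [← maximalIdeal_height_eq_ringKrullDim]
      exact Ideal.height_le_ringKrullDim_quotient_add_one hx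
    have hdim' : (d : WithBot ℕ∞) ≤ ringKrullDim (A ⧸ Ideal.span {x}) := by
      rw [← maximalIdeal_height_eq_ringKrullDim] at hdim ⊢
      obtain ⟨n, hn⟩ := ENat.ne_top_iff_exists.mp
        (Ideal.height_ne_top (maximalIdeal.isMaximal (A ⧸ Ideal.span {x})).ne_top)
      rw [← hn] at hdim ⊢
      norm_cast at hdim ⊢
      omega
    have hreg : IsRegularLocalRing (A ⧸ Ideal.span {x}) :=
      .of_spanFinrank_maximalIdeal_le _ ((Nat.cast_le.mpr hrank).trans hdim')
    have hrank' : (maximalIdeal (A ⧸ Ideal.span {x})).spanFinrank = d := by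
      refine le_antisymm hrank ?_
      rw [← IsRegularLocalRing.spanFinrank_maximalIdeal] at hdim'
      exact_mod_cast hdim'
    obtain ⟨hdom, rs, hrs, hw⟩ := ih hrank'
    have hA : IsDomain A := isDomain_of_isPrime_span_singleton hx
      ((Ideal.Quotient.isDomain_iff_prime _).mp hdom) hmin
    refine ⟨hA, ?_⟩
    obtain ⟨l, rfl⟩ := List.map_surjective_iff.mpr
      (Ideal.Quotient.mk_surjective (I := Ideal.span {x})) rs
    refine ⟨x :: l, ?_, ?_⟩
    · rw [← Ideal.map_ofList, ← hmax] at hrs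
      have := congrArg (Ideal.comap π) hrs
      rw [Ideal.comap_map_of_surjective π Ideal.Quotient.mk_surjective,
        Ideal.comap_map_of_surjective π Ideal.Quotient.mk_surjective] at this
      have hk : Ideal.comap π ⊥ = Ideal.span {x} := Ideal.mk_ker
      rw [hk, sup_eq_left.mpr hle] at this
      rw [Ideal.ofList_cons, sup_comm]; exact this
    · have hx0 : x ≠ 0 := by
        rintro rfl
        exact hx2 (zero_mem _)
      rw [isWeaklyRegular_cons_iff']
      refine ⟨IsSMulRegular.of_ne_zero hx0, ?_⟩
      let e : (A ⧸ Ideal.span {x}) ≃ₗ[A] QuotSMulTop x A := Submodule.quotEquivOfEq _ _ (by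
        rw [← Submodule.ideal_span_singleton_smul]; simp)
      exact ((e.extendScalarsOfSurjective
        Ideal.Quotient.mk_surjective).isWeaklyRegular_congr _).mp hw

/-! ### Flatness of Frobenius -/

/-- Only the images of the generators in `B` enter, so that it applies with `B = A` to Frobenius,
where they are the `p`-th powers. -/
theorem RingHom.Flat.of_isWeaklyRegular {A B : Type*} [CommRing A] [CommRing B] [IsLocalRing A]
    [IsNoetherianRing A] {f : A →+* B} (hf : f.Finite) {rs : List A}
    (hrs : Ideal.ofList rs = maximalIdeal A) (hreg : IsWeaklyRegular B (rs.map f)) : f.Flat := by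
  algebraize [f]
  have hreg' : IsWeaklyRegular B rs := (isWeaklyRegular_map_algebraMap_iff (S := B) B rs).mp hreg
  have := Module.free_of_isWeaklyRegular_of_ofList_eq_maximalIdeal rs hrs hreg'
  exact inferInstanceAs (Module.Flat A B)

theorem IsRegularLocalRing.flat_frobenius {A : Type*} [CommRing A] [IsRegularLocalRing A]
    (p : ℕ) [Fact p.Prime] [CharP A p] (hF : (frobenius A p).Finite) : (frobenius A p).Flat := by
  obtain ⟨-, rs, hrs, hreg⟩ := IsRegularLocalRing.isDomain_and_exists_isWeaklyRegular (A := A)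
  refine .of_isWeaklyRegular hF hrs (hreg.map_pow (fun r hr => ?_) (Fact.out : p.Prime).ne_zero)
  exact hrs ▸ Ideal.subset_span hr

/-- In a commutative square over `f`, a map `f'` whose target is generated, up to multiplication by
its range, by the image of the target of `f` is finite. -/
theorem RingHom.Finite.of_comp_eq {A A' B B' : Type*} [CommRing A] [CommRing A'] [CommRing B]
    [CommRing B'] {f : A →+* B} {f' : A' →+* B'} {g : A →+* A'} {h : B →+* B'}
    (hcomm : h.comp f = f'.comp g) (hf : f.Finite)
    (hsurj : ∀ x : B', ∃ a b, x = f' a * h b) : f'.Finite := by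
  classical
  algebraize [f, f', g, h, h.comp f]
  have : IsScalarTower A A' B' := .of_algebraMap_eq' hcomm
  obtain ⟨s, hs⟩ := Module.Finite.fg_top (R := A) (M := B)
  refine ⟨⟨s.image h, top_le_iff.mp fun x _ => ?_⟩⟩
  obtain ⟨a, b, rfl⟩ := hsurj x
  have hb : b ∈ Submodule.span A (s : Set B) := hs ▸ Submodule.mem_top
  have hb' := Submodule.mem_map_of_mem (f := (IsScalarTower.toAlgHom A B B').toLinearMap) hb
  rw [Submodule.map_span] at hb'
  have hb'' := Submodule.span_le_restrictScalars A A' _ hb'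
  rw [Finset.coe_image]
  exact Submodule.smul_mem _ a hb''

theorem RingHom.Finite.frobenius_of_isLocalization {R S : Type*} [CommRing R] [CommRing S]
    [Algebra R S] (M : Submonoid R) [IsLocalization M S] (p : ℕ) [ExpChar R p] [ExpChar S p]
    (hF : (frobenius R p).Finite) : (frobenius S p).Finite := by
  refine hF.of_comp_eq (g := algebraMap R S) (h := algebraMap R S)
    (RingHom.frobenius_comm _ p) fun x => ?_
  obtain ⟨r, t, rfl⟩ := IsLocalization.exists_mk'_eq M x
  refine ⟨IsLocalization.mk' S 1 t, r * t ^ (p - 1), ?_⟩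
  have hp : 0 < p := expChar_pos R p
  rw [frobenius_def, ← IsLocalization.mk'_pow, ← IsLocalization.mk'_one (M := M) S (r * _),
    ← IsLocalization.mk'_mul]
  refine IsLocalization.mk'_eq_of_eq ?_
  simp only [one_pow, one_mul, mul_one, SubmonoidClass.coe_pow]
  rw [← mul_pow_sub_one hp.ne' (t : R)]
  ring

/-- The F-finite case of Kunz's theorem that regular rings have flat Frobenius. -/
theorem IsRegularRing.flat_frobenius {R : Type*} [CommRing R] [IsRegularRing R]
    (p : ℕ) [Fact p.Prime] [CharP R p] (hF : (frobenius R p).Finite) : (frobenius R p).Flat := by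
  refine RingHom.Flat.ofLocalizationPrime _ fun P hP => ?_
  have hcomap : P = P.comap (frobenius R p) := by
    ext x
    simp [frobenius_def, hP.pow_mem_iff_mem p (Fact.out : p.Prime).pos]
  have : CharP (Localization.AtPrime P) p :=
    (CharP.charP_iff_prime_eq_zero Fact.out).mpr (by
      rw [← map_natCast (algebraMap R _), CharP.cast_eq_zero, map_zero])
  have h : (Localization.localRingHom P P (frobenius R p) hcomap).Flat := by
    rw [Localization.localRingHom_unique P P _ hcomap (j := frobenius _ p)
      fun x => (RingHom.map_frobenius _ p x).symm]
    exact IsRegularLocalRing.flat_frobenius p (hF.frobenius_of_isLocalization P.primeCompl p)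
  have aux : ∀ (Q : Ideal R) [Q.IsPrime] (hQ : Q = P.comap (frobenius R p)) (_ : Q = P),
      (Localization.localRingHom Q P (frobenius R p) hQ).Flat := by
    rintro Q _ hQ rfl
    exact h
  exact aux _ rfl hcomap.symm

/-- A finite flat algebra over a Noetherian ring is projective; the `φ i` are the coordinate functions
of an embedding as a direct summand of a finite free module. -/
theorem RingHom.Flat.exists_coordinates {A B : Type*} [CommRing A] [CommRing B]
    [IsNoetherianRing A] {f : A →+* B} (hf : f.Flat) (hfin : f.Finite) :
    ∃ (n : ℕ) (φ : Fin n → B → A), (∀ (J : Ideal A) (y : B), y ∈ J.map f ↔ ∀ i, φ i y ∈ J) ∧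
      ∀ i a y, φ i (f a * y) = a * φ i y := by
  algebraize [f]
  have : Module.FinitePresentation A B := Module.finitePresentation_of_finite A B
  have : Module.Projective A B := Module.Flat.projective_of_finitePresentation
  obtain ⟨n, π, g, -, -, hπg⟩ := Module.Finite.exists_comp_eq_id_of_projective A B
  have hlin : ∀ i a y, g (f a * y) i = a * g y i := fun i a y => by
    rw [← RingHom.algebraMap_toAlgebra f, ← Algebra.smul_def, map_smul]
    rfl
  refine ⟨n, fun i y => g y i, fun J y => ⟨fun hy i => ?_, fun hy => ?_⟩, hlin⟩
  · suffices h : ∀ b, g (b * y) i ∈ J by simpa using h 1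
    induction hy using Submodule.span_induction with
    | mem x hx =>
      obtain ⟨a, ha, rfl⟩ := hx
      intro b
      rw [mul_comm, hlin]
      exact J.mul_mem_right _ ha
    | zero => simp
    | add x y _ _ hx hy =>
      intro b
      rw [mul_add, map_add]
      exact J.add_mem (hx b) (hy b)
    | smul c x _ hx =>
      intro b
      rw [smul_eq_mul, ← mul_assoc]
      exact hx (b * c)
  · have h : y = π (g y) := (LinearMap.congr_fun hπg y).symm
    rw [h, pi_eq_sum_univ (g y), map_sum]
    refine Ideal.sum_mem _ fun i _ => ?_
    rw [map_smul, Algebra.smul_def]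
    exact Ideal.mul_mem_right _ _ (Ideal.mem_map_of_mem f (hy i))

end Kunz

namespace FTest

/-! ### Frobenius powers and thresholds -/

section Basic

variable {R : Type*} [CommRing R] {p : ℕ}

theorem frobPower_mono {e : ℕ} {I J : Ideal R} (h : I ≤ J) : frobPower p e I ≤ frobPower p e J :=
  Ideal.span_mono (Set.image_mono h)

theorem frobPower_eq_map [ExpChar R p] (e : ℕ) (J : Ideal R) :
    frobPower p e J = J.map (iterateFrobenius R p e) := rfl

theorem frobPower_frobPower [ExpChar R p] (d e : ℕ) (J : Ideal R) :
    frobPower p e (frobPower p d J) = frobPower p (e + d) J := by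
  simp_rw [frobPower_eq_map, Ideal.map_map, iterateFrobenius_add]

theorem frobPower_le_pow (e : ℕ) (J : Ideal R) : frobPower p e J ≤ J ^ p ^ e := by
  rw [frobPower, Ideal.span_le]
  rintro _ ⟨u, hu, rfl⟩
  exact Ideal.pow_mem_pow hu _

theorem frobPower_le_self [Fact p.Prime] (e : ℕ) (J : Ideal R) : frobPower p e J ≤ J :=
  (frobPower_le_pow e J).trans (Ideal.pow_le_self (pow_ne_zero _ (Fact.out : p.Prime).ne_zero))

theorem frobPower_pow_le (e r : ℕ) (a : Ideal R) : frobPower p e (a ^ r) ≤ a ^ (r * p ^ e) := by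
  rw [pow_mul]
  exact frobPower_le_pow e _

theorem frobPower_span_singleton_of_isIdempotentElem [Fact p.Prime] {u : R}
    (hu : IsIdempotentElem u) (e : ℕ) : frobPower p e (Ideal.span {u}) = Ideal.span {u} := by
  refine le_antisymm (frobPower_le_self e _) ?_
  rw [Ideal.span_singleton_le_iff_mem]
  have h : u ^ p ^ e = u := hu.pow_eq (pow_ne_zero _ (Fact.out : p.Prime).ne_zero)
  exact Ideal.subset_span ⟨u, Ideal.mem_span_singleton_self u, h⟩

theorem fThreshold_nonneg (p : ℕ) (a J : Ideal R) : 0 ≤ fThreshold p a J :=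
  Real.iSup_nonneg fun _ => by positivity

theorem fThreshold_top (p : ℕ) (a : Ideal R) : fThreshold p a ⊤ = 0 := by
  have hnu : ∀ e, nu p a ⊤ e = 0 := fun e => by
    have h : frobPower p e (⊤ : Ideal R) = ⊤ :=
      (Ideal.eq_top_iff_one _).mpr (Ideal.subset_span ⟨1, trivial, one_pow _⟩)
    simp [nu, h]
  simp [fThreshold, hnu]

/-- The restriction `0 < r` matters when `J^[p^e]` is the unit ideal: then `ν(p^e) = 0` by
convention. -/
theorem pow_le_frobPower_iff_nu_lt [IsNoetherianRing R] [Fact p.Prime] {a J : Ideal R}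
    (h : a ≤ J.radical) {e r : ℕ} (hr : 0 < r) :
    a ^ r ≤ frobPower p e J ↔ nu p a J e < r := by
  have hbdd := nu_bddAbove (Fact.out : p.Prime).pos h e
  constructor
  · intro hle
    by_contra! hlt
    have hne : {r : ℕ | ¬ a ^ r ≤ frobPower p e J}.Nonempty := by
      by_contra hemp
      rw [Set.not_nonempty_iff_eq_empty] at hemp
      rw [nu, hemp, csSup_empty] at hlt
      exact hr.not_ge hlt
    exact Nat.sSup_mem hne hbdd ((Ideal.pow_le_pow_right hlt).trans hle)
  · intro hlt
    by_contra hle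
    exact hlt.not_ge (le_csSup hbdd hle)

end Basic

variable {R : Type*} [CommRing R] [IsRegularRing R] {p : ℕ} [Fact p.Prime] [CharP R p]

/-! ### Frobenius roots -/

theorem flat_iterateFrobenius (hF : (frobenius R p).Finite) (e : ℕ) :
    (iterateFrobenius R p e).Flat ∧ (iterateFrobenius R p e).Finite := by
  induction e with
  | zero =>
    rw [iterateFrobenius_zero]
    exact ⟨.id R, .id R⟩
  | succ e ih =>
    rw [iterateFrobenius_add, iterateFrobenius_one]
    exact ⟨(IsRegularRing.flat_frobenius p hF).comp ih.1, ih.2.comp hF⟩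

theorem mem_frobPower_sInf (hF : (frobenius R p).Finite) {e : ℕ} {S : Set (Ideal R)} {x : R}
    (hx : ∀ J ∈ S, x ∈ frobPower p e J) : x ∈ frobPower p e (sInf S) := by
  obtain ⟨h1, h2⟩ := flat_iterateFrobenius hF e
  obtain ⟨n, φ, hφ, -⟩ := RingHom.Flat.exists_coordinates h1 h2
  simp only [frobPower_eq_map, hφ, Ideal.mem_sInf] at hx ⊢
  exact fun i J hJ => hx J hJ i

/-- The inclusion `(J^[q] : x^q) ≤ (J : x)^[q]`, a consequence of flatness. -/
theorem mem_frobPower_colon (hF : (frobenius R p).Finite) {e : ℕ} {J : Ideal R} {x y : R}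
    (h : x ^ p ^ e * y ∈ frobPower p e J) : y ∈ frobPower p e (J.colon {x}) := by
  obtain ⟨h1, h2⟩ := flat_iterateFrobenius hF e
  obtain ⟨n, φ, hφ, hlin⟩ := RingHom.Flat.exists_coordinates h1 h2
  rw [← iterateFrobenius_def] at h
  simp only [frobPower_eq_map, hφ, hlin, Submodule.mem_colon_singleton] at h ⊢
  exact fun i => by simpa [mul_comm] using h i

/-- If `x^q ∈ J^[q]` then `(J : x)^[q]` is the unit ideal, hence so is `J : x`. -/
theorem le_of_frobPower_le (hF : (frobenius R p).Finite) {e : ℕ} {I J : Ideal R}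
    (h : frobPower p e I ≤ frobPower p e J) : I ≤ J := by
  intro x hx
  have h1 : x ^ p ^ e * 1 ∈ frobPower p e J := by
    rw [mul_one]
    exact h (Ideal.subset_span ⟨x, hx, rfl⟩)
  have h2 := frobPower_le_self e _ (mem_frobPower_colon hF h1)
  simpa [Submodule.mem_colon_singleton] using h2

/-- The intersection defining `b^[1/p^e]` is itself one of the ideals `J` with `b ≤ J^[p^e]`. -/
theorem frobRoot_le_iff (hF : (frobenius R p).Finite) {e : ℕ} {b J : Ideal R} :
    frobRoot p e b ≤ J ↔ b ≤ frobPower p e J :=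
  ⟨fun h _ hx => frobPower_mono h (mem_frobPower_sInf hF fun K (hK : b ≤ frobPower p e K) => hK hx),
    fun h => sInf_le h⟩

theorem frobRoot_pow_le_succ (hF : (frobenius R p).Finite) {a : Ideal R} {e r s : ℕ}
    (h : s ≤ r * p) : frobRoot p e (a ^ r) ≤ frobRoot p (e + 1) (a ^ s) := by
  rw [frobRoot_le_iff hF]
  refine le_of_frobPower_le hF (e := 1) ?_
  rw [frobPower_frobPower, add_comm]
  refine (frobPower_pow_le 1 r a).trans ((Ideal.pow_le_pow_right ?_).trans
    ((frobRoot_le_iff hF).mp le_rfl))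
  simpa using h

/-! ### Test ideals -/

/-- `τ(a^0)` is generated by an idempotent, and it is the smallest ideal `L` with `a ≤ L^[p^e]` for
all `e`: that ideal is the stable value `K` of the chain `a^[1/p^e]`, and `K ≤ K^[p] ≤ K²`. -/
theorem exists_testIdealZero (hF : (frobenius R p).Finite) (a : Ideal R) :
    ∃ u : R, IsIdempotentElem u ∧ testIdealZero a = Ideal.span {u} ∧ a ≤ Ideal.span {u} ∧
      ∀ L : Ideal R, (∀ e, a ≤ frobPower p e L) → Ideal.span {u} ≤ L := by
  have hmono : Monotone fun e => frobRoot p e a := monotone_nat_of_le_succ fun e => by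
    simpa using frobRoot_pow_le_succ hF (a := a) (e := e) (r := 1) (s := 1)
      (by simpa using (Fact.out : p.Prime).one_le)
  obtain ⟨n, hn⟩ := monotone_stabilizes_iff_noetherian.mpr
    (inferInstanceAs (IsNoetherian R R)) ⟨_, hmono⟩
  have hn' : ∀ m, frobRoot p m a ≤ frobRoot p n a := fun m =>
    (hmono (le_max_left m n)).trans (hn (max m n) (le_max_right m n)).ge
  have hle : a ≤ frobRoot p n a :=
    ((frobRoot_le_iff hF).mp le_rfl).trans (frobPower_le_self n _)
  have hidem : IsIdempotentElem (frobRoot p n a) := by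
    refine le_antisymm Ideal.mul_le_right ?_
    have h1 : frobRoot p n a ≤ frobPower p 1 (frobRoot p n a) := by
      rw [frobRoot_le_iff hF, frobPower_frobPower]
      exact (frobRoot_le_iff hF).mp (hn' (n + 1))
    rw [← pow_two]
    refine (h1.trans (frobPower_le_pow 1 _)).trans (Ideal.pow_le_pow_right ?_)
    simpa using (Fact.out : p.Prime).two_le
  obtain ⟨u, hu, hspan⟩ := (Ideal.isIdempotentElem_iff_of_fg _
    (IsNoetherian.noetherian (frobRoot p n a))).mp hidem
  have hspan' : frobRoot p n a = Ideal.span {u} := hspan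
  rw [hspan'] at hle
  have hmin : ∀ L : Ideal R, (∀ e, a ≤ frobPower p e L) → Ideal.span {u} ≤ L := fun L hL => by
    rw [← hspan', frobRoot_le_iff hF]
    exact hL n
  refine ⟨u, hu, le_antisymm (sInf_le ⟨hle, u, hu, rfl⟩) (le_sInf ?_), hle, hmin⟩
  rintro K ⟨haK, v, hv, rfl⟩
  exact hmin _ fun e => by rwa [frobPower_span_singleton_of_isIdempotentElem hv]

theorem testIdeal_le_iff (hF : (frobenius R p).Finite) {a J : Ideal R} {c : ℝ} (hc : 0 < c) :
    testIdeal p a c ≤ J ↔ ∀ e : ℕ, 0 < e → a ^ ⌈c * (p : ℝ) ^ e⌉₊ ≤ frobPower p e J := by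
  rw [testIdeal, if_neg hc.ne']
  simp only [iSup_le_iff, frobRoot_le_iff hF]

theorem pow_ceil_le_frobPower_testIdeal (hF : (frobenius R p).Finite) (a : Ideal R) {c : ℝ}
    (hc : 0 < c) {e : ℕ} (he : 0 < e) :
    a ^ ⌈c * (p : ℝ) ^ e⌉₊ ≤ frobPower p e (testIdeal p a c) :=
  (testIdeal_le_iff hF hc).mp le_rfl e he

theorem testIdeal_antitone (hF : (frobenius R p).Finite) (a : Ideal R) {c d : ℝ} (hc : 0 ≤ c)
    (hcd : c ≤ d) : testIdeal p a d ≤ testIdeal p a c := by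
  rcases hcd.eq_or_lt with rfl | hlt
  · exact le_rfl
  have hd : 0 < d := hc.trans_lt hlt
  have hp : (0 : ℝ) < p := by exact_mod_cast (Fact.out : p.Prime).pos
  rw [testIdeal_le_iff hF hd]
  intro e he
  rcases hc.eq_or_lt with rfl | hc
  · obtain ⟨u, hu, hu1, hu2, -⟩ := exists_testIdealZero hF a
    rw [testIdeal, if_pos rfl, hu1, frobPower_span_singleton_of_isIdempotentElem hu]
    exact (Ideal.pow_le_self (Nat.ceil_pos.mpr (by positivity)).ne').trans hu2
  · refine (Ideal.pow_le_pow_right (Nat.ceil_mono ?_)).trans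
      (pow_ceil_le_frobPower_testIdeal hF a hc he)
    gcongr

/-- To bound `τ(a^c)` it suffices to test the exponents `⌊c p^e⌋ + 1` in place of `⌈c p^e⌉`. They differ
when `k = c p^e` is an integer; then `x ∈ a^k` satisfies `x^(p^d) a ≤ J^[p^(e+d)]` for all `d`, so
`J^[p^e] : x` contains `τ(a^0)`, whose idempotent generator fixes `x`. -/
theorem testIdeal_le_of_forall_pow_floor_succ_le (hF : (frobenius R p).Finite) {a J : Ideal R}
    {c : ℝ} (hc : 0 ≤ c) (h : ∀ e : ℕ, a ^ (⌊c * (p : ℝ) ^ e⌋₊ + 1) ≤ frobPower p e J) :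
    testIdeal p a c ≤ J := by
  have hp : (0 : ℝ) < p := by exact_mod_cast (Fact.out : p.Prime).pos
  obtain ⟨u, hu, hu1, hu2, hu3⟩ := exists_testIdealZero hF a
  rcases hc.eq_or_lt with rfl | hc
  · rw [testIdeal, if_pos rfl, hu1]
    exact hu3 J fun e => by simpa using h e
  rw [testIdeal_le_iff hF hc]
  intro e _
  by_cases hk : (⌈c * (p : ℝ) ^ e⌉₊ : ℝ) = c * (p : ℝ) ^ e
  · set k := ⌈c * (p : ℝ) ^ e⌉₊ with hkdef
    have hk0 : k ≠ 0 := (Nat.ceil_pos.mpr (by positivity)).ne'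
    intro x hx
    have hL : Ideal.span {u} ≤ (frobPower p e J).colon {x} := by
      refine hu3 _ fun d y hy => mem_frobPower_colon hF ?_
      rw [frobPower_frobPower, add_comm]
      have hfloor : ⌊c * (p : ℝ) ^ (e + d)⌋₊ = k * p ^ d := by
        rw [pow_add, ← mul_assoc, ← hk]
        exact_mod_cast Nat.floor_natCast (k * p ^ d)
      refine h (e + d) ?_
      rw [hfloor, pow_succ, pow_mul]
      exact Ideal.mul_mem_mul (Ideal.pow_mem_pow hx _) hy
    have hux : u * x ∈ frobPower p e J := by
      have := hL (Ideal.mem_span_singleton_self u)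
      simpa [Submodule.mem_colon_singleton] using this
    obtain ⟨z, rfl⟩ := Ideal.mem_span_singleton.mp (hu2 (Ideal.pow_le_self hk0 hx))
    rwa [← mul_assoc, hu.eq] at hux
  · refine (Ideal.pow_le_pow_right ?_).trans (h e)
    rw [Nat.add_one_le_iff, Nat.lt_ceil]
    refine lt_of_le_of_ne (Nat.floor_le (by positivity)) fun hfl => hk ?_
    rw [← hfl, Nat.ceil_natCast]

/-- Right-continuity: the ideals `(a^(⌊c p^e⌋ + 1))^[1/p^e]` increase with `e`; their stable value
contains `τ(a^c)` and is contained in `τ(a^d)` for some `d = (⌊c p^e⌋ + 1) / p^e > c`. -/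
theorem exists_lt_testIdeal_le (hF : (frobenius R p).Finite) (a : Ideal R) {c : ℝ} (hc : 0 ≤ c) :
    ∃ d, c < d ∧ testIdeal p a c ≤ testIdeal p a d := by
  have hp : (0 : ℝ) < p := by exact_mod_cast (Fact.out : p.Prime).pos
  have hmono : Monotone fun e => frobRoot p e (a ^ (⌊c * (p : ℝ) ^ e⌋₊ + 1)) :=
    monotone_nat_of_le_succ fun e => frobRoot_pow_le_succ hF (by
      rw [Nat.add_one_le_iff, Nat.floor_lt (by positivity), pow_succ, ← mul_assoc]
      push_cast
      gcongr
      exact Nat.lt_floor_add_one _)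
  obtain ⟨n, hn⟩ := monotone_stabilizes_iff_noetherian.mpr
    (inferInstanceAs (IsNoetherian R R)) ⟨_, hmono⟩
  have hpn : (0 : ℝ) < (p : ℝ) ^ (n + 1) := by positivity
  have hd : c < (⌊c * (p : ℝ) ^ (n + 1)⌋₊ + 1 : ℕ) / (p : ℝ) ^ (n + 1) := by
    rw [lt_div_iff₀ hpn]
    exact_mod_cast Nat.lt_floor_add_one _
  refine ⟨_, hd, testIdeal_le_of_forall_pow_floor_succ_le hF hc fun e => ?_⟩
  rw [← frobRoot_le_iff hF]
  refine (hmono (le_max_left e (n + 1))).trans ?_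
  refine (hn (max e (n + 1)) ((Nat.le_succ n).trans (le_max_right _ _))).ge.trans ?_
  refine (hn (n + 1) n.le_succ).le.trans ?_
  refine (frobRoot_le_iff hF).mpr ?_
  have h := pow_ceil_le_frobPower_testIdeal hF a (hc.trans_lt hd) n.succ_pos
  rwa [Nat.succ_eq_add_one, div_mul_cancel₀ _ hpn.ne', Nat.ceil_natCast] at h

/-! ### Jumping exponents and thresholds -/

theorem testIdeal_le_iff_nu_lt (hF : (frobenius R p).Finite) {a J : Ideal R} (h : a ≤ J.radical)
    {c : ℝ} (hc : 0 < c) :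
    testIdeal p a c ≤ J ↔ ∀ e : ℕ+, (nu p a J e : ℝ) / (p : ℝ) ^ (e : ℕ) < c := by
  have hp : (0 : ℝ) < p := by exact_mod_cast (Fact.out : p.Prime).pos
  have key : ∀ e : ℕ, a ^ ⌈c * (p : ℝ) ^ e⌉₊ ≤ frobPower p e J ↔
      (nu p a J e : ℝ) / (p : ℝ) ^ e < c := fun e => by
    rw [pow_le_frobPower_iff_nu_lt h (Nat.ceil_pos.mpr (by positivity)), Nat.lt_ceil,
      div_lt_iff₀ (by positivity)]
  rw [testIdeal_le_iff hF hc]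
  simp only [key]
  exact ⟨fun H e => H e e.pos, fun H e he => H ⟨e, he⟩⟩

theorem testIdeal_le_of_fThreshold_lt (hF : (frobenius R p).Finite) {a J : Ideal R}
    (h : a ≤ J.radical) {c : ℝ} (hc : fThreshold p a J < c) : testIdeal p a c ≤ J := by
  rw [testIdeal_le_iff_nu_lt hF h ((fThreshold_nonneg p a J).trans_lt hc)]
  exact fun e => (le_ciSup (fThreshold_bddAbove (Fact.out : p.Prime).pos h) e).trans_lt hc

theorem fThreshold_le_of_testIdeal_le (hF : (frobenius R p).Finite) {a J : Ideal R}
    (h : a ≤ J.radical) {c : ℝ} (hc : 0 < c) (hJ : testIdeal p a c ≤ J) : fThreshold p a J ≤ c :=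
  ciSup_le fun e => ((testIdeal_le_iff_nu_lt hF h hc).mp hJ e).le

theorem le_radical_testIdeal (hF : (frobenius R p).Finite) (a : Ideal R) {c : ℝ} (hc : 0 < c) :
    a ≤ (testIdeal p a c).radical := fun _ hx =>
  ⟨_, frobPower_le_self 1 _
    (pow_ceil_le_frobPower_testIdeal hF a hc one_pos (Ideal.pow_mem_pow hx _))⟩

theorem isFJumpingExponent_fThreshold (hF : (frobenius R p).Finite) {a J : Ideal R}
    (h : a ≤ J.radical) : IsFJumpingExponent p a (fThreshold p a J) := by
  rcases (fThreshold_nonneg p a J).eq_or_lt with h0 | h0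
  · exact Or.inl h0.symm
  refine Or.inr ⟨h0, fun ε hε hεc heq => ?_⟩
  obtain ⟨d, hd, hle⟩ := exists_lt_testIdeal_le hF a h0.le
  have hJ : testIdeal p a (fThreshold p a J - ε) ≤ J :=
    heq ▸ hle.trans (testIdeal_le_of_fThreshold_lt hF h hd)
  -- `τ(a^0)` is not described by `ν`, so pass to `c - ε / 2`, which is positive even if `ε = c`
  have h1 : testIdeal p a (fThreshold p a J - ε / 2) ≤ J :=
    (testIdeal_antitone hF a (by linarith) (by linarith)).trans hJ
  have h2 := fThreshold_le_of_testIdeal_le hF h (by linarith) h1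
  linarith

/-- A jumping exponent `c > 0` is the threshold with respect to `τ(a^c)`. -/
theorem fThreshold_testIdeal_eq (hF : (frobenius R p).Finite) {a : Ideal R} {c : ℝ} (hc : 0 < c)
    (hjump : ∀ ε : ℝ, 0 < ε → ε ≤ c → testIdeal p a c ≠ testIdeal p a (c - ε)) :
    fThreshold p a (testIdeal p a c) = c := by
  have hrad := le_radical_testIdeal hF a hc
  refine le_antisymm (fThreshold_le_of_testIdeal_le hF hrad hc le_rfl) ?_
  by_contra! hlt
  obtain ⟨d, hd1, hd2⟩ := exists_between hlt
  have hd0 : 0 ≤ d := (fThreshold_nonneg p a _).trans hd1.le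
  refine hjump (c - d) (by linarith) (by linarith) ?_
  rw [sub_sub_cancel]
  exact le_antisymm (testIdeal_antitone hF a hd0 hd2.le)
    (testIdeal_le_of_fThreshold_lt hF hrad hd1)

end FTest

theorem corollary2p21 {R : Type*} [CommRing R] [IsRegularRing R] (p : ℕ) [Fact p.Prime] [CharP R p]
    (hF : (frobenius R p).Finite) (a : Ideal R) :
    {c : ℝ | FTest.IsFJumpingExponent p a c} =
      {c : ℝ | ∃ J : Ideal R, a ≤ J.radical ∧ c = FTest.fThreshold p a J} := by
  ext c
  constructor
  · rintro (rfl | ⟨hc, hjump⟩)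
    · exact ⟨⊤, le_top.trans Ideal.le_radical, (FTest.fThreshold_top p a).symm⟩
    · exact ⟨_, FTest.le_radical_testIdeal hF a hc,
        (FTest.fThreshold_testIdeal_eq hF hc hjump).symm⟩
  · rintro ⟨J, hJ, rfl⟩
    exact FTest.isFJumpingExponent_fThreshold hF hJ
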